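/- Let $\eta,\xi\in\mathbb{R}[x]$ be real polynomials without real zeros. For $p\in\{\eta,\xi\}$ put $W_p=p^{-2}e^{-x^2}$ and let $\mathcal{H}_p=L^2(\mathbb{R},W_p\,dx)$ be the Hilbert space of complex-valued functions. Write $\operatorname{Wr}(f,g)=fg'-f'g$, $\tilde p=p\,e^{x^2}$, $$\chi(f,g)=fg''-2f'g'+f''g-2x\,(fg'-f'g),\qquad \tau_p\,y=p^{-1}\chi(p,y),$$ $$\alpha_{\xi,\eta}\,y=\eta^{-1}\operatorname{Wr}(\xi,y),\qquad \beta_{\eta,\xi}\,y=\tilde\xi^{-1}\operatorname{Wr}(\tilde\eta,y).$$ Let $AC_{\mathrm{loc}}(\mathbb{R})$ be the functions $\mathbb{R}\to\mathbb{C}$ that are absolutely continuous on every compact interval, and $AC^1_{\mathrm{loc}}(\mathbb{R})$ the differentiable functions whose derivative lies in $AC_{\mathrm{loc}}(\mathbb{R})$. Let $A_{\xi,\eta}:\mathcal{H}_\eta\to\mathcal{H}_\xi$, $B_{\eta,\xi}:\mathcal{H}_\xi\to\mathcal{H}_\eta$ and $T_p:\mathcal{H}_p\to\mathcal{H}_p$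 be the operators with actions $\alpha_{\xi,\eta}$, $\beta_{\eta,\xi}$ and $\tau_p$, respectively, and with the maximal domains $$\operatorname{Dom}A_{\xi,\eta}=\{f\in\mathcal{H}_\eta\cap AC_{\mathrm{loc}}(\mathbb{R}) : \alpha_{\xi,\eta}f\in\mathcal{H}_\xi\},\qquad \operatorname{Dom}B_{\eta,\xi}=\{g\in\mathcal{H}_\xi\cap AC_{\mathrm{loc}}(\mathbb{R}) : \beta_{\eta,\xi}g\in\mathcal{H}_\eta\},$$ $$\operatorname{Dom}T_p=\{f\in\mathcal{H}_p\cap AC^1_{\mathrm{loc}}(\mathbb{R}) : \tau_pf\in\mathcal{H}_p\}.$$ Suppose that $\chi(\eta,\xi)=\varepsilon_0\,\eta\,\xi$ for some $\varepsilon_0\in\mathbb{R}$. Then, as equalities of unbounded operators (equal domains and equal actions), $$T_\eta=B_{\eta,\xi}A_{\xi,\eta}+\varepsilon_0,\qquad T_\xi=A_{\xi,\eta}B_{\eta,\xi}+\varepsilon_0+2,$$ where the compositions have their natural domains $$\operatorname{Dom}B_{\eta,\xi}A_{\xi,\eta}=\{f\in\operatorname{Dom}A_{\xi,\eta} : A_{\xi,\eta}f\in\operatorname{Dom}B_{\eta,\xi}\},\qquad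 \operatorname{Dom}A_{\xi,\eta}B_{\eta,\xi}=\{g\in\operatorname{Dom}B_{\eta,\xi} : B_{\eta,\xi}g\in\operatorname{Dom}A_{\xi,\eta}\}.$$ -/

import Mathlib

open MeasureTheory Filter Polynomial
open scoped Topology ENNReal

noncomputable section

namespace XHermite

/-- Real polynomials without real zeros. -/
def NoRealZeros : Set ℝ[X] := {p | ∀ x : ℝ, p.eval x ≠ 0}

/-- A real polynomial as a complex-valued function on the real line. -/
def polyFun (p : ℝ[X]) : ℝ → ℂ := fun x => ((p.eval x : ℝ) : ℂ)

/-! ### Differential expressions -/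

/-- The Wronskian `f g' - f' g`. -/
def wr (f g : ℝ → ℂ) : ℝ → ℂ := fun x => f x * deriv g x - deriv f x * g x

/-- `χ(f,g) = f g'' - 2 f' g' + f'' g - 2 x (f g' - f' g)`. -/
def chi (f g : ℝ → ℂ) : ℝ → ℂ := fun x =>
  f x * deriv (deriv g) x - 2 * deriv f x * deriv g x + deriv (deriv f) x * g x
    - 2 * (x : ℂ) * (f x * deriv g x - deriv f x * g x)

/-- `f e^{x²}`. -/
def tilde (f : ℝ → ℂ) : ℝ → ℂ := fun x => f x * Complex.exp ((x : ℂ) ^ 2)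

/-- `α_{f,g} y = g⁻¹ Wr(f, y)`. -/
def alpha (f g : ℝ → ℂ) (y : ℝ → ℂ) : ℝ → ℂ := fun x => (g x)⁻¹ * wr f y x

/-- `β_{g,f} = α_{g e^{x²}, f e^{x²}}`. -/
def beta (g f : ℝ → ℂ) (y : ℝ → ℂ) : ℝ → ℂ := alpha (tilde g) (tilde f) y

/-- `τ_f y = f⁻¹ χ(f, y)`. -/
def tau (f : ℝ → ℂ) (y : ℝ → ℂ) : ℝ → ℂ := fun x => (f x)⁻¹ * chi f y x

/-! ### Weighted Hilbert spaces -/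

/-- The weight `W_η = η^{-2} e^{-x²}`. -/
def weight (η : ℝ[X]) (x : ℝ) : ℝ := ((η.eval x) ^ 2)⁻¹ * Real.exp (-x ^ 2)

/-- The measure `W_η(x) dx`. -/
def weightMeasure (η : ℝ[X]) : Measure ℝ :=
  (volume : Measure ℝ).withDensity fun x => ENNReal.ofReal (weight η x)

/-- The complex Hilbert space `L²(ℝ, W_η)`. -/
abbrev H (η : ℝ[X]) : Type := Lp ℂ 2 (weightMeasure η)

theorem measurable_weight (η : ℝ[X]) : Measurable (weight η) := by
  unfold weight
  have h : Measurable fun x : ℝ => η.eval x := η.continuous.measurable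
  fun_prop

theorem weightMeasure_ac (η : ℝ[X]) : weightMeasure η ≪ volume :=
  withDensity_absolutelyContinuous _ _

theorem volume_ac_weightMeasure {η : ℝ[X]} (hη : η ∈ NoRealZeros) :
    (volume : Measure ℝ) ≪ weightMeasure η := by
  refine withDensity_absolutelyContinuous' (measurable_weight η).ennreal_ofReal.aemeasurable ?_
  refine Eventually.of_forall fun x => ?_
  have h := hη x
  have : 0 < weight η x := by unfold weight; positivity
  simpa using this

/-! ### Local absolute continuity -/

/-- `AC_loc(ℝ)`: absolutely continuous on every compact interval. -/
def ACloc : Submodule ℂ (ℝ → ℂ) where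
  carrier := {u | ∀ a b : ℝ, AbsolutelyContinuousOnInterval u a b}
  add_mem' hu hv a b := (hu a b).add (hv a b)
  zero_mem' a b := by
    simpa [AbsolutelyContinuousOnInterval] using tendsto_const_nhds
  smul_mem' c _ hu a b := (hu a b).const_smul c

/-- `AC¹_loc(ℝ)`: differentiable, with derivative in `AC_loc(ℝ)`. -/
def AC1loc : Submodule ℂ (ℝ → ℂ) where
  carrier := {u | Differentiable ℝ u ∧ deriv u ∈ ACloc}
  add_mem' {u v} hu hv := by
    refine ⟨hu.1.add hv.1, ?_⟩
    have : deriv (u + v) = deriv u + deriv v := by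
      funext x; exact deriv_add (hu.1 x) (hv.1 x)
    rw [this]
    exact ACloc.add_mem hu.2 hv.2
  zero_mem' := by
    have : deriv (0 : ℝ → ℂ) = 0 := by funext x; simp
    refine ⟨differentiable_const (0 : ℂ), ?_⟩
    rw [this]
    exact ACloc.zero_mem
  smul_mem' c u hu := by
    refine ⟨hu.1.const_smul c, ?_⟩
    have : deriv (c • u) = c • deriv u := by
      funext x; exact deriv_const_smul c (hu.1 x)
    rw [this]
    exact ACloc.smul_mem c hu.2

theorem continuous_of_mem_ACloc {u : ℝ → ℂ} (hu : u ∈ ACloc) : Continuous u := by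
  rw [continuous_iff_continuousAt]
  intro x
  refine (hu (x - 1) (x + 1)).continuousOn.continuousAt ?_
  rw [Set.uIcc_of_le (by linarith)]
  exact Icc_mem_nhds (by linarith) (by linarith)

theorem ae_differentiableAt_of_mem_ACloc {u : ℝ → ℂ} (hu : u ∈ ACloc) :
    ∀ᵐ x : ℝ, DifferentiableAt ℝ u x := by
  have h : ∀ n : ℕ, ∀ᵐ x : ℝ, x ∈ Set.uIcc (-(n : ℝ)) n → DifferentiableAt ℝ u x := fun n =>
    (hu (-(n : ℝ)) n).boundedVariationOn.ae_differentiableAt_of_mem_uIcc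
  filter_upwards [ae_all_iff.2 h] with x hx
  obtain ⟨n, hn⟩ := exists_nat_ge |x|
  refine hx n ?_
  rw [Set.uIcc_of_le (by linarith [abs_nonneg x])]
  exact ⟨(abs_le.1 hn).1, (abs_le.1 hn).2⟩

theorem deriv_smul_fun (c : ℂ) (u : ℝ → ℂ) : deriv (c • u) = c • deriv u := by
  funext x; simp [deriv_const_smul_field]

/-! ### Maximal operators -/

/-- An expression `L` is a.e. linear on a class of functions `S`. -/
structure IsAELinearOn (S : Submodule ℂ (ℝ → ℂ)) (L : (ℝ → ℂ) → ℝ → ℂ) : Prop where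
  add : ∀ u ∈ S, ∀ v ∈ S, L (u + v) =ᵐ[volume] L u + L v
  smul : ∀ (c : ℂ), ∀ u ∈ S, L (c • u) =ᵐ[volume] c • L u

/-- The graph of the maximal operator with action `L`, on the class `S`: the pairs `(f, h)` of
`L²` classes such that `f` has a representative `u` in `S` and `h` is the class of `L u`. -/
def maximalGraph (η ξ : ℝ[X]) {S : Submodule ℂ (ℝ → ℂ)} {L : (ℝ → ℂ) → ℝ → ℂ}
    (hL : IsAELinearOn S L) : Submodule ℂ (H η × H ξ) where
  carrier := {p | ∃ u ∈ S, p.1 =ᵐ[weightMeasure η] u ∧ p.2 =ᵐ[weightMeasure ξ] L u}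
  add_mem' := by
    rintro p q ⟨u, hu, h1, h2⟩ ⟨v, hv, k1, k2⟩
    refine ⟨u + v, S.add_mem hu hv, ?_, ?_⟩
    · exact (Lp.coeFn_add p.1 q.1).trans (h1.add k1)
    · exact ((Lp.coeFn_add p.2 q.2).trans (h2.add k2)).trans
        ((weightMeasure_ac ξ).ae_eq (hL.add u hu v hv)).symm
  zero_mem' := by
    refine ⟨0, S.zero_mem, Lp.coeFn_zero _ _ _, ?_⟩
    have h := (weightMeasure_ac ξ).ae_eq (hL.smul 0 0 S.zero_mem)
    rw [zero_smul, zero_smul] at h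
    exact (Lp.coeFn_zero _ _ _).trans h.symm
  smul_mem' := by
    rintro c p ⟨u, hu, h1, h2⟩
    refine ⟨c • u, S.smul_mem c hu, ?_, ?_⟩
    · exact (Lp.coeFn_smul c p.1).trans (h1.const_smul c)
    · exact ((Lp.coeFn_smul c p.2).trans (h2.const_smul c)).trans
        ((weightMeasure_ac ξ).ae_eq (hL.smul c u hu)).symm

/-- The maximal operator `H η → H ξ` with action `L`: its domain consists of the `f ∈ H η` with a
representative `u ∈ S` such that `L u ∈ H ξ`, and it sends `f` to `L u`. -/
def maximalOp (η ξ : ℝ[X]) {S : Submodule ℂ (ℝ → ℂ)} {L : (ℝ → ℂ) → ℝ → ℂ}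
    (hL : IsAELinearOn S L) : H η →ₗ.[ℂ] H ξ :=
  (maximalGraph η ξ hL).toLinearPMap

/-- When the functions in `S` are continuous and `η` has no real zeros, the graph of `maximalOp`
really is `maximalGraph` (the representative `u` is unique). -/
theorem mem_graph_maximalOp {η ξ : ℝ[X]} (hη : η ∈ NoRealZeros)
    {S : Submodule ℂ (ℝ → ℂ)} (hS : ∀ u ∈ S, Continuous u) {L : (ℝ → ℂ) → ℝ → ℂ}
    (hL : IsAELinearOn S L) (f : H η) (h : H ξ) :
    (f, h) ∈ (maximalOp η ξ hL).graph ↔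
      ∃ u ∈ S, f =ᵐ[weightMeasure η] u ∧ h =ᵐ[weightMeasure ξ] L u := by
  unfold maximalOp
  rw [Submodule.toLinearPMap_graph_eq]
  · rfl
  · rintro p ⟨u, hu, h1, h2⟩ hp
    rw [hp] at h1
    have h0 : u =ᵐ[volume] (0 : ℝ → ℂ) :=
      (volume_ac_weightMeasure hη).ae_eq (h1.symm.trans (Lp.coeFn_zero _ _ _))
    have h0' : u = 0 := Measure.eq_of_ae_eq h0 (hS u hu) continuous_zero
    subst h0'
    have h3 := (weightMeasure_ac ξ).ae_eq (hL.smul 0 0 S.zero_mem)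
    rw [zero_smul, zero_smul] at h3
    exact Lp.ext ((h2.trans h3).trans (Lp.coeFn_zero _ _ _).symm)

theorem alpha_linear (f g : ℝ → ℂ) : IsAELinearOn ACloc (alpha f g) where
  add u hu v hv := by
    filter_upwards [ae_differentiableAt_of_mem_ACloc hu, ae_differentiableAt_of_mem_ACloc hv]
      with x h1 h2
    simp only [alpha, wr, Pi.add_apply, deriv_add h1 h2]
    ring
  smul c u _ := Eventually.of_forall fun x => by
    simp only [alpha, wr, deriv_smul_fun, Pi.smul_apply, smul_eq_mul]
    ring

theorem beta_linear (g f : ℝ → ℂ) : IsAELinearOn ACloc (beta g f) := alpha_linear _ _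

theorem tau_linear (f : ℝ → ℂ) : IsAELinearOn AC1loc (tau f) where
  add u hu v hv := by
    filter_upwards [ae_differentiableAt_of_mem_ACloc hu.2, ae_differentiableAt_of_mem_ACloc hv.2]
      with x h1 h2
    have h3 : deriv (u + v) = deriv u + deriv v := by
      funext y; exact deriv_add (hu.1 y) (hv.1 y)
    simp only [tau, chi, h3, Pi.add_apply, deriv_add h1 h2]
    ring
  smul c u _ := Eventually.of_forall fun x => by
    simp only [tau, chi, deriv_smul_fun, Pi.smul_apply, smul_eq_mul]
    ring

/-- `A_{ξ,η} : H η → H ξ`, with domain `{f ∈ H η ∩ AC_loc : α_{ξ,η} f ∈ H ξ}`. -/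
def A (ξ η : ℝ[X]) : H η →ₗ.[ℂ] H ξ :=
  maximalOp η ξ (alpha_linear (polyFun ξ) (polyFun η))

/-- `B_{η,ξ} : H ξ → H η`, with domain `{g ∈ H ξ ∩ AC_loc : β_{η,ξ} g ∈ H η}`. -/
def B (η ξ : ℝ[X]) : H ξ →ₗ.[ℂ] H η :=
  maximalOp ξ η (beta_linear (polyFun η) (polyFun ξ))

/-- `T_η : H η → H η`, with domain `{f ∈ H η ∩ AC¹_loc : τ_η f ∈ H η}`. -/
def T (η : ℝ[X]) : H η →ₗ.[ℂ] H η :=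
  maximalOp η η (tau_linear (polyFun η))

theorem mem_graph_A {ξ η : ℝ[X]} (hη : η ∈ NoRealZeros) (f : H η) (h : H ξ) :
    (f, h) ∈ (A ξ η).graph ↔ ∃ u ∈ ACloc, f =ᵐ[weightMeasure η] u ∧
      h =ᵐ[weightMeasure ξ] alpha (polyFun ξ) (polyFun η) u :=
  mem_graph_maximalOp hη (fun _ hu => continuous_of_mem_ACloc hu) _ f h

theorem mem_graph_B {η ξ : ℝ[X]} (hξ : ξ ∈ NoRealZeros) (g : H ξ) (h : H η) :
    (g, h) ∈ (B η ξ).graph ↔ ∃ u ∈ ACloc, g =ᵐ[weightMeasure ξ] u ∧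
      h =ᵐ[weightMeasure η] beta (polyFun η) (polyFun ξ) u :=
  mem_graph_maximalOp hξ (fun _ hu => continuous_of_mem_ACloc hu) _ g h

theorem mem_graph_T {η : ℝ[X]} (hη : η ∈ NoRealZeros) (f h : H η) :
    (f, h) ∈ (T η).graph ↔ ∃ u ∈ AC1loc, f =ᵐ[weightMeasure η] u ∧
      h =ᵐ[weightMeasure η] tau (polyFun η) u :=
  mem_graph_maximalOp hη (fun _ (hu : Differentiable ℝ _ ∧ _) => hu.1.continuous) _ f h

/-! ### Natural composition -/

/-- The composition `g ∘ f` of partially defined linear operators, on its natural domain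
`{x ∈ Dom f : f x ∈ Dom g}`. -/
def natComp {E F G : Type*} [AddCommGroup E] [Module ℂ E] [AddCommGroup F] [Module ℂ F]
    [AddCommGroup G] [Module ℂ G] (g : F →ₗ.[ℂ] G) (f : E →ₗ.[ℂ] F) : E →ₗ.[ℂ] G where
  domain :=
    { carrier := {x | ∃ hx : x ∈ f.domain, f ⟨x, hx⟩ ∈ g.domain}
      add_mem' := by
        rintro x y ⟨hx, hx'⟩ ⟨hy, hy'⟩
        refine ⟨f.domain.add_mem hx hy, ?_⟩
        have h := f.map_add ⟨x, hx⟩ ⟨y, hy⟩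
        exact h ▸ g.domain.add_mem hx' hy'
      zero_mem' := by
        refine ⟨f.domain.zero_mem, ?_⟩
        have h := f.map_zero
        exact h ▸ g.domain.zero_mem
      smul_mem' := by
        rintro c x ⟨hx, hx'⟩
        refine ⟨f.domain.smul_mem c hx, ?_⟩
        have h := f.map_smul c ⟨x, hx⟩
        exact h ▸ g.domain.smul_mem c hx' }
  toFun :=
    { toFun := fun x => g ⟨f ⟨x.1, x.2.1⟩, x.2.2⟩
      map_add' := by
        rintro ⟨x, hx, hx'⟩ ⟨y, hy, hy'⟩
        rw [← g.map_add]
        congr 1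
        exact Subtype.ext (f.map_add ⟨x, hx⟩ ⟨y, hy⟩)
      map_smul' := by
        rintro c ⟨x, hx, hx'⟩
        rw [RingHom.id_apply, ← g.map_smul]
        congr 1
        exact Subtype.ext (f.map_smul c ⟨x, hx⟩) }

/-- `S + c`, with the same domain as `S`. -/
def addScalar {E : Type*} [AddCommGroup E] [Module ℂ E] (S : E →ₗ.[ℂ] E) (c : ℂ) :
    E →ₗ.[ℂ] E :=
  (c • (LinearMap.id : E →ₗ[ℂ] E)) +ᵥ S

end XHermite

end

/-!
Write `p`, `q` for the two polynomials and `W_p`, `W_q` for the weights. Pointwise, `τ_p = β α + c`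
is a computation that uses only the equation for `χ` (`tau_eq_beta_alpha`, `tau_eq_alpha_beta`).
What remains is the equality of domains.

If `y` is in the domain of the composition, then `α y` agrees almost everywhere with a locally
absolutely continuous function. Solving for the derivative shows that `y'` is almost everywhere
equal to a locally absolutely continuous function, so that `y` is in `AC¹_loc`
(`mem_AC1loc_of_alpha_ae_eq`).

Conversely, let `y` be in the domain of `T_p`. It has to be shown that `g = α y` is square
integrable, knowing only that `y` and `k = β g` are. With `m² = W_p W_q`, the function `m ȳ g` has
derivative `W_q |g|² + W_p ȳ k` (`hasDerivAt_lagrange`). Multiplying by the cutoff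
`(1 - x² / R²)²`, integrating over `[-R, R]` and absorbing half of the term with `|g|²` bounds
`∫ W_q |g|²` over `[-R/2, R/2]` uniformly in `R` (`integrable_of_cutoff`). No information on the
behaviour of the coefficients at infinity enters, and the same argument serves both
factorizations, since `m ȳ g` is symmetric in the two spaces up to conjugation.
-/

namespace XHermite

/-! ### Locally absolutely continuous functions -/

theorem absolutelyContinuousOnInterval_comp_of_dist_le {X Y : Type*} [PseudoMetricSpace X]
    [PseudoMetricSpace Y] {f : ℝ → X} {φ : X → Y} {a b : ℝ}
    (hφ : ∀ x y, dist (φ x) (φ y) ≤ dist x y) (hf : AbsolutelyContinuousOnInterval f a b) :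
    AbsolutelyContinuousOnInterval (fun x => φ (f x)) a b :=
  squeeze_zero (fun _ => Finset.sum_nonneg fun _ _ => dist_nonneg)
    (fun _ => Finset.sum_le_sum fun _ _ => hφ _ _) hf

theorem mul_mem_ACloc {u v : ℝ → ℂ} (hu : u ∈ ACloc) (hv : v ∈ ACloc) :
    (fun x => u x * v x) ∈ ACloc := fun a b => (hu a b).smul (hv a b)

theorem mem_ACloc_of_contDiff {u : ℝ → ℂ} (hu : ContDiff ℝ 1 u) : u ∈ ACloc := fun _ _ =>
  hu.contDiffOn.absolutelyContinuousOnInterval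

/-- A locally absolutely continuous function whose derivative agrees almost everywhere with a
continuous function is differentiable everywhere. -/
theorem hasDerivAt_of_ae_deriv_eq {u r : ℝ → ℂ} (hu : u ∈ ACloc) (hr : Continuous r)
    (h : ∀ᵐ x, deriv u x = r x) (x : ℝ) : HasDerivAt u (r x) x := by
  -- the difference of `u` and a primitive of `r` has derivative zero almost everywhere
  set R : ℝ → ℂ := fun x => ∫ t in (0 : ℝ)..x, r t with hR
  have hRd : ∀ x, HasDerivAt R (r x) x := fun x =>
    (hr.integral_hasStrictDerivAt 0 x).hasDerivAt
  have hRd' : deriv R = r := funext fun x => (hRd x).deriv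
  have hRc : R ∈ ACloc := mem_ACloc_of_contDiff <| by
    rw [contDiff_one_iff_deriv, hRd']
    exact ⟨fun x => (hRd x).differentiableAt, hr⟩
  have hconst : ∀ y, u y - R y = u x - R x := by
    intro y
    obtain ⟨C, hC⟩ := ((hu x y).sub (hRc x y)).const_of_ae_hasDerivAt_zero (by
      filter_upwards [h, ae_differentiableAt_of_mem_ACloc hu] with z hz hd _
      have := hd.hasDerivAt.sub (hRd z)
      rwa [hz, sub_self] at this)
    have h1 := hC x Set.left_mem_uIcc
    have h2 := hC y Set.right_mem_uIcc
    simp only [Pi.sub_apply] at h1 h2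
    rw [h1, h2]
  have hu' : u = fun y => R y + (u x - R x) := by
    funext y; rw [← hconst y]; ring
  rw [hu']
  exact (hRd x).add_const _

/-! ### The cutoff estimate -/

/-- The cutoff estimate. If `F' ≥ Q - K` with `F² ≤ P Q`, where `P`, `K` are integrable, then `Q`
is integrable. Nothing is assumed on the growth of `F`. -/
theorem integrable_of_cutoff {F P Q K : ℝ → ℝ}
    (hF : ∀ a b, AbsolutelyContinuousOnInterval F a b) (hQ : Continuous Q) (hQ0 : ∀ x, 0 ≤ Q x)
    (hP0 : ∀ x, 0 ≤ P x) (hK0 : ∀ x, 0 ≤ K x) (hP : Integrable P) (hK : Integrable K)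
    (hPQ : ∀ x, F x ^ 2 ≤ P x * Q x) (hd : ∀ᵐ x, Q x - K x ≤ deriv F x) : Integrable Q := by
  have key : ∀ R : ℝ, 1 ≤ R → ∫ x in (-R / 2)..(R / 2), Q x ≤ 32 * (∫ x, P x) + 4 * ∫ x, K x := by
    intro R hR
    have hR0 : 0 < R := by linarith
    set φ : ℝ → ℝ := fun x => (1 - x ^ 2 / R ^ 2) ^ 2 with hφ
    set φ' : ℝ → ℝ := fun x => 2 * (1 - x ^ 2 / R ^ 2) * (-(2 * x) / R ^ 2) with hφ'
    have hφd : ∀ x, HasDerivAt φ (φ' x) x := by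
      intro x
      have h := (((hasDerivAt_pow 2 x).div_const (R ^ 2)).const_sub 1).pow 2
      refine h.congr_deriv ?_
      simp only [hφ']; push_cast; ring
    have hφc : Continuous φ := by fun_prop
    have hφe : deriv φ = φ' := funext fun x => (hφd x).deriv
    have hφac : AbsolutelyContinuousOnInterval φ (-R) R := by
      refine ContDiffOn.absolutelyContinuousOnInterval (ContDiff.contDiffOn ?_)
      fun_prop
    -- the boundary terms vanish because the cutoff is zero at `±R`
    have hibp := hφac.integral_deriv_mul_eq_sub (hF (-R) R)
    have hφR : φ R = 0 := by simp [hφ, hR0.ne']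
    have hφR' : φ (-R) = 0 := by simp [hφ, hR0.ne']
    rw [hφR, hφR', hφe] at hibp
    -- pointwise lower bound of the integrand, by `2ab ≤ a²/2 + 2b²`
    have hlow : ∀ᵐ x, x ∈ Set.Icc (-R) R →
        φ x / 2 * Q x - (8 * P x + K x) ≤ φ' x * F x + φ x * deriv F x := by
      filter_upwards [hd] with x hx hxR
      have hx2 : x ^ 2 ≤ R ^ 2 := sq_le_sq' hxR.1 hxR.2
      set s : ℝ := 1 - x ^ 2 / R ^ 2 with hs
      have hs0 : 0 ≤ s := by
        rw [hs, sub_nonneg]; exact div_le_one_of_le₀ hx2 (by positivity)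
      have hs1 : s ≤ 1 := by
        rw [hs]; have : 0 ≤ x ^ 2 / R ^ 2 := by positivity
        linarith
      set t : ℝ := 2 * x / R ^ 2 with ht
      have ht2 : t ^ 2 ≤ 4 := by
        rw [ht, div_pow, div_le_iff₀ (by positivity)]
        have : R ^ 2 ≤ (R ^ 2) ^ 2 := le_self_pow₀ (one_le_pow₀ hR) two_ne_zero
        nlinarith
      have h1 : φ x = s ^ 2 := rfl
      have h2 : φ' x = -(2 * s * t) := by simp only [hφ', ht, hs]; ring
      rw [h1, h2]
      have hA : |2 * s * t * F x| ≤ s ^ 2 / 2 * Q x + 2 * t ^ 2 * P x := by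
        refine abs_le_of_sq_le_sq ?_ (by have := hQ0 x; have := hP0 x; positivity)
        have h3 := mul_le_mul_of_nonneg_left (hPQ x) (sq_nonneg (2 * s * t))
        nlinarith [sq_nonneg (s ^ 2 / 2 * Q x - 2 * t ^ 2 * P x)]
      have hB : s ^ 2 * (Q x - K x) ≤ s ^ 2 * deriv F x :=
        mul_le_mul_of_nonneg_left hx (sq_nonneg s)
      have hC : s ^ 2 * K x ≤ K x :=
        mul_le_of_le_one_left (hK0 x) (pow_le_one₀ hs0 hs1)
      have hD : t ^ 2 * P x ≤ 4 * P x := mul_le_mul_of_nonneg_right ht2 (hP0 x)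
      have := (abs_le.1 hA).2
      nlinarith
    have hRR : -R ≤ R := by linarith
    have hPK : Integrable fun x => 8 * P x + K x := (hP.const_mul 8).add hK
    have hi1 : IntervalIntegrable (fun x => φ x / 2 * Q x) volume (-R) R :=
      Continuous.intervalIntegrable (by fun_prop) _ _
    have hφ'c : Continuous φ' := by fun_prop
    have hi3 : IntervalIntegrable (fun x => φ' x * F x + φ x * deriv F x) volume (-R) R :=
      ((hF (-R) R).continuousOn.intervalIntegrable.continuousOn_mul hφ'c.continuousOn).add
        ((hF (-R) R).intervalIntegrable_deriv.continuousOn_mul hφc.continuousOn)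
    have h5 : ∫ x in (-R)..R, (φ x / 2 * Q x - (8 * P x + K x)) ≤
        ∫ x in (-R)..R, (φ' x * F x + φ x * deriv F x) := by
      refine intervalIntegral.integral_mono_ae_restrict hRR (hi1.sub hPK.intervalIntegrable) hi3 ?_
      rw [EventuallyLE, ae_restrict_iff' measurableSet_Icc]
      exact hlow
    rw [hibp, intervalIntegral.integral_sub hi1 hPK.intervalIntegrable] at h5
    have h6 : ∫ x in (-R)..R, (8 * P x + K x) ≤ 8 * (∫ x, P x) + ∫ x, K x := by
      rw [← integral_const_mul, ← integral_add (hP.const_mul 8) hK,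
        intervalIntegral.integral_of_le hRR]
      refine setIntegral_le_integral hPK (Eventually.of_forall fun x => ?_)
      have := hP0 x; have := hK0 x
      simp only [Pi.zero_apply]; positivity
    -- the cutoff is at least `1/2` on the inner half of the interval
    have h7 : ∫ x in (-R / 2)..(R / 2), Q x / 4 ≤ ∫ x in (-R / 2)..(R / 2), φ x / 2 * Q x := by
      refine intervalIntegral.integral_mono_on (by linarith)
        (Continuous.intervalIntegrable (by fun_prop) _ _)
        (Continuous.intervalIntegrable (by fun_prop) _ _) fun x hx => ?_
      have hx2 : x ^ 2 ≤ (R / 2) ^ 2 := sq_le_sq' (by linarith [hx.1]) hx.2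
      have h8 : x ^ 2 / R ^ 2 ≤ 1 / 4 := by
        rw [div_le_iff₀ (by positivity)]; linarith
      have h9 : (1 / 2 : ℝ) ≤ φ x := by
        simp only [hφ]
        nlinarith [sq_nonneg (1 - x ^ 2 / R ^ 2)]
      nlinarith [hQ0 x]
    have h10 : ∫ x in (-R / 2)..(R / 2), φ x / 2 * Q x ≤ ∫ x in (-R)..R, φ x / 2 * Q x := by
      refine intervalIntegral.integral_mono_interval (by linarith) (by linarith) (by linarith)
        (Eventually.of_forall fun x => ?_) hi1
      have := hQ0 x
      simp only [hφ, Pi.zero_apply]; positivity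
    rw [intervalIntegral.integral_div] at h7
    linarith
  refine integrable_of_intervalIntegral_norm_bounded (l := atTop) (a := fun R : ℝ => -R / 2)
    (b := fun R : ℝ => R / 2) (32 * (∫ x, P x) + 4 * ∫ x, K x) (fun R => ?_) ?_ ?_ ?_
  · exact (hQ.integrableOn_Icc).mono_set Set.Ioc_subset_Icc_self
  · exact tendsto_neg_atTop_atBot.atBot_div_const (by norm_num)
  · exact tendsto_id.atTop_div_const (by norm_num)
  · filter_upwards [eventually_ge_atTop 1] with R hR
    simpa only [Real.norm_of_nonneg (hQ0 _)] using key R hR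

/-! ### Graphs of compositions and translates -/

theorem mem_graph_natComp {E F G : Type*} [AddCommGroup E] [Module ℂ E] [AddCommGroup F]
    [Module ℂ F] [AddCommGroup G] [Module ℂ G] (g : F →ₗ.[ℂ] G) (f : E →ₗ.[ℂ] F) (x : E) (z : G) :
    (x, z) ∈ (natComp g f).graph ↔ ∃ y, (x, y) ∈ f.graph ∧ (y, z) ∈ g.graph := by
  constructor
  · intro h
    obtain ⟨⟨w, hw, hw'⟩, rfl, rfl⟩ := (LinearPMap.mem_graph_iff _).1 h
    exact ⟨f ⟨w, hw⟩, f.mem_graph ⟨w, hw⟩, g.mem_graph ⟨_, hw'⟩⟩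
  · rintro ⟨y, h1, h2⟩
    obtain ⟨⟨w, hw⟩, rfl, rfl⟩ := (LinearPMap.mem_graph_iff _).1 h1
    obtain ⟨⟨v, hv⟩, hvw, rfl⟩ := (LinearPMap.mem_graph_iff _).1 h2
    dsimp only at hvw
    subst hvw
    exact (natComp g f).mem_graph ⟨w, hw, hv⟩

theorem mem_graph_addScalar {E : Type*} [AddCommGroup E] [Module ℂ E] (S : E →ₗ.[ℂ] E) (c : ℂ)
    (x z : E) : (x, z) ∈ (addScalar S c).graph ↔ (x, z - c • x) ∈ S.graph := by
  simp only [LinearPMap.mem_graph_iff]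
  constructor
  · rintro ⟨⟨w, hw⟩, rfl, rfl⟩
    refine ⟨⟨w, hw⟩, rfl, ?_⟩
    change S ⟨w, hw⟩ = (c • w + S ⟨w, hw⟩) - c • w
    abel
  · rintro ⟨⟨w, hw⟩, rfl, h⟩
    refine ⟨⟨w, hw⟩, rfl, ?_⟩
    change c • w + S ⟨w, hw⟩ = z
    rw [h]
    dsimp only
    abel

/-! ### Weighted square integrability -/

theorem continuous_weight {p : ℝ[X]} (hp : p ∈ NoRealZeros) : Continuous (weight p) := by
  unfold weight
  have h : Continuous fun x => p.eval x := p.continuous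
  exact ((h.pow 2).inv₀ fun x => pow_ne_zero 2 (hp x)).mul (by fun_prop)

theorem weight_nonneg (p : ℝ[X]) (x : ℝ) : 0 ≤ weight p x := by
  unfold weight; positivity

theorem memLp_weightMeasure_iff {p : ℝ[X]} {u : ℝ → ℂ}
    (hu : AEStronglyMeasurable u (weightMeasure p)) :
    MemLp u 2 (weightMeasure p) ↔ Integrable fun x => weight p x * ‖u x‖ ^ 2 := by
  rw [memLp_two_iff_integrable_sq_norm hu, weightMeasure,
    integrable_withDensity_iff_integrable_smul' (measurable_weight p).ennreal_ofReal
      (Eventually.of_forall fun x => ENNReal.ofReal_lt_top)]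
  simp only [ENNReal.toReal_ofReal (weight_nonneg p _), smul_eq_mul]

/-! ### First-order expressions -/

/-- If `g⁻¹ Wr(f, y)` agrees almost
everywhere with a locally absolutely continuous function, then `y` is in `AC¹_loc` and the
agreement holds everywhere: the equation can be solved for `y'`. -/
theorem mem_AC1loc_of_alpha_ae_eq {f g y k : ℝ → ℂ} (hf : ContDiff ℝ 2 f) (hg : ContDiff ℝ 2 g)
    (hf0 : ∀ x, f x ≠ 0) (hg0 : ∀ x, g x ≠ 0) (hy : y ∈ ACloc) (hk : k ∈ ACloc)
    (h : alpha f g y =ᵐ[volume] k) : y ∈ AC1loc ∧ alpha f g y = k := by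
  have hf' : ContDiff ℝ 1 (deriv f) := hf.deriv' (n := 1)
  set r : ℝ → ℂ := fun x => (f x)⁻¹ * (g x * k x + deriv f x * y x) with hr
  have hr' : r ∈ ACloc := mul_mem_ACloc
    (mem_ACloc_of_contDiff ((hf.inv hf0).of_le (by norm_num)))
    (ACloc.add_mem (mul_mem_ACloc (mem_ACloc_of_contDiff (hg.of_le (by norm_num))) hk)
      (mul_mem_ACloc (mem_ACloc_of_contDiff hf') hy))
  have hd : ∀ x, HasDerivAt y (r x) x := by
    refine hasDerivAt_of_ae_deriv_eq hy (continuous_of_mem_ACloc hr') ?_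
    filter_upwards [h] with x hx
    have h1 := hf0 x
    have h2 := hg0 x
    simp only [hr, ← hx, alpha, wr]
    field_simp
    ring
  have hd' : deriv y = r := funext fun x => (hd x).deriv
  refine ⟨⟨fun x => (hd x).differentiableAt, hd' ▸ hr'⟩, funext fun x => ?_⟩
  have h1 := hf0 x
  have h2 := hg0 x
  simp only [alpha, wr, hd', hr]
  field_simp
  ring

theorem AC1loc_le_ACloc : AC1loc ≤ ACloc := fun _ hu => mem_ACloc_of_contDiff <|
  contDiff_one_iff_deriv.2 ⟨hu.1, continuous_of_mem_ACloc hu.2⟩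

theorem alpha_mem_ACloc {f g y : ℝ → ℂ} (hf : ContDiff ℝ 2 f) (hg : ContDiff ℝ 2 g)
    (hg0 : ∀ x, g x ≠ 0) (hy : y ∈ AC1loc) : alpha f g y ∈ ACloc :=
  mul_mem_ACloc (mem_ACloc_of_contDiff ((hg.inv hg0).of_le (by norm_num)))
    (ACloc.sub_mem (mul_mem_ACloc (mem_ACloc_of_contDiff (hf.of_le (by norm_num))) hy.2)
      (mul_mem_ACloc (mem_ACloc_of_contDiff (hf.deriv' (n := 1))) (AC1loc_le_ACloc hy)))

/-! ### From pointwise to operator factorization -/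

/-- The intermediate function `g` lies in the weighted `L²` space as soon as `y` and `k` do,
provided that `y`, `g`, `k` are linked by the Lagrange identity
`(m ȳ g)' = W_q |g|² + W_p ȳ k`, where `m² = W_p W_q`. -/
theorem memLp_of_lagrange {p q : ℝ[X]} (hq : q ∈ NoRealZeros)
    {m : ℝ → ℂ} (hm : ContDiff ℝ 1 m) (hm2 : ∀ x, ‖m x‖ ^ 2 = weight p x * weight q x)
    {y g k : ℝ → ℂ} (hy : y ∈ ACloc) (hg : g ∈ ACloc)
    (hyL : MemLp y 2 (weightMeasure p)) (hkL : MemLp k 2 (weightMeasure p))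
    (hd : ∀ᵐ x, HasDerivAt (fun x => m x * (starRingEnd ℂ (y x) * g x))
      (weight q x * (starRingEnd ℂ (g x) * g x) + weight p x * (starRingEnd ℂ (y x) * k x)) x) :
    MemLp g 2 (weightMeasure q) := by
  have hgc := continuous_of_mem_ACloc hg
  rw [memLp_weightMeasure_iff hgc.aestronglyMeasurable]
  have hyc : (fun x => starRingEnd ℂ (y x)) ∈ ACloc := fun a b =>
    absolutelyContinuousOnInterval_comp_of_dist_le
      (fun z w => by rw [dist_eq_norm, ← map_sub, RCLike.norm_conj, dist_eq_norm]) (hy a b)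
  have hFc := mul_mem_ACloc (mem_ACloc_of_contDiff hm) (mul_mem_ACloc hyc hg)
  refine integrable_of_cutoff (F := fun x => (m x * (starRingEnd ℂ (y x) * g x)).re)
    (P := fun x => weight p x * ‖y x‖ ^ 2) (K := fun x => weight p x * (‖y x‖ * ‖k x‖))
    (fun a b => absolutelyContinuousOnInterval_comp_of_dist_le (fun z w => ?_) (hFc a b))
    ((continuous_weight hq).mul (hgc.norm.pow 2)) (fun x => ?_) (fun x => ?_) (fun x => ?_)
    ((memLp_weightMeasure_iff hyL.1).1 hyL) ?_ (fun x => ?_) ?_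
  · rw [Real.dist_eq, ← Complex.sub_re, dist_eq_norm]
    exact Complex.abs_re_le_norm _
  · exact mul_nonneg (weight_nonneg q x) (sq_nonneg _)
  · exact mul_nonneg (weight_nonneg p x) (sq_nonneg _)
  · exact mul_nonneg (weight_nonneg p x) (mul_nonneg (norm_nonneg _) (norm_nonneg _))
  · have h : Integrable (fun x => ‖y x‖ * ‖k x‖) (weightMeasure p) :=
      hyL.norm.integrable_mul hkL.norm
    rw [weightMeasure, integrable_withDensity_iff_integrable_smul'
      (measurable_weight p).ennreal_ofReal
      (Eventually.of_forall fun x => ENNReal.ofReal_lt_top)] at h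
    simpa only [ENNReal.toReal_ofReal (weight_nonneg p _), smul_eq_mul] using h
  · calc (m x * (starRingEnd ℂ (y x) * g x)).re ^ 2
        ≤ ‖m x * (starRingEnd ℂ (y x) * g x)‖ ^ 2 :=
          sq_le_sq' (neg_le_of_abs_le (Complex.abs_re_le_norm _))
            ((le_abs_self _).trans (Complex.abs_re_le_norm _))
      _ = ‖m x‖ ^ 2 * (‖y x‖ ^ 2 * ‖g x‖ ^ 2) := by
          rw [norm_mul, norm_mul, RCLike.norm_conj]; ring
      _ = weight p x * ‖y x‖ ^ 2 * (weight q x * ‖g x‖ ^ 2) := by rw [hm2]; ring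
      _ ≤ _ := le_rfl
  · filter_upwards [hd] with x hx
    have h1 : HasDerivAt (fun x => (m x * (starRingEnd ℂ (y x) * g x)).re) _ x :=
      Complex.reCLM.hasFDerivAt.comp_hasDerivAt x hx
    rw [h1.deriv]
    simp only [Complex.reCLM_apply, Complex.add_re, Complex.re_ofReal_mul]
    have h2 : (starRingEnd ℂ (g x) * g x).re = ‖g x‖ ^ 2 := by
      rw [mul_comm, Complex.mul_conj, Complex.ofReal_re, Complex.normSq_eq_norm_sq]
    have h3 : -(‖y x‖ * ‖k x‖) ≤ (starRingEnd ℂ (y x) * k x).re := by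
      have := neg_le_of_abs_le (Complex.abs_re_le_norm (starRingEnd ℂ (y x) * k x))
      rwa [norm_mul, RCLike.norm_conj] at this
    rw [h2]
    nlinarith [mul_le_mul_of_nonneg_left h3 (weight_nonneg p x)]

/-- If `τ_p - c` factors pointwise into two first-order expressions that are formally antiadjoint
with respect to the weights (`hd`), then the maximal operators factor as well, with equal
domains. -/
theorem maximalOp_tau_eq_of_factorization {p q : ℝ[X]} (hp : p ∈ NoRealZeros)
    (hq : q ∈ NoRealZeros) {f₁ g₁ f₂ g₂ m : ℝ → ℂ} (c : ℂ)
    (hf₁ : ContDiff ℝ 2 f₁) (hg₁ : ContDiff ℝ 2 g₁)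
    (hf₁0 : ∀ x, f₁ x ≠ 0) (hg₁0 : ∀ x, g₁ x ≠ 0)
    (hm : ContDiff ℝ 1 m) (hm2 : ∀ x, ‖m x‖ ^ 2 = weight p x * weight q x)
    (hτ : ∀ (y : ℝ → ℂ) (x : ℝ), Differentiable ℝ y → DifferentiableAt ℝ (deriv y) x →
      tau (polyFun p) y x = alpha f₂ g₂ (alpha f₁ g₁ y) x + c * y x)
    (hd : ∀ (y g : ℝ → ℂ) (x : ℝ), DifferentiableAt ℝ y x → DifferentiableAt ℝ g x →
      HasDerivAt (fun x => m x * (starRingEnd ℂ (y x) * g x))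
        (weight q x * (starRingEnd ℂ (alpha f₁ g₁ y x) * g x) +
          weight p x * (starRingEnd ℂ (y x) * alpha f₂ g₂ g x)) x) :
    T p = addScalar (natComp (maximalOp q p (alpha_linear f₂ g₂))
      (maximalOp p q (alpha_linear f₁ g₁))) c := by
  refine LinearPMap.eq_of_eq_graph (Submodule.ext fun ⟨f, h⟩ => ?_)
  have hAC : ∀ u ∈ ACloc, Continuous u := fun _ hu => continuous_of_mem_ACloc hu
  rw [mem_graph_T hp, mem_graph_addScalar, mem_graph_natComp]
  simp only [mem_graph_maximalOp hp hAC, mem_graph_maximalOp hq hAC]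
  have hsub := Lp.coeFn_sub h (c • f)
  have hsmul := Lp.coeFn_smul c f
  constructor
  · rintro ⟨u, hu, hfu, hhu⟩
    have huAC := AC1loc_le_ACloc hu
    have hgAC : alpha f₁ g₁ u ∈ ACloc := alpha_mem_ACloc hf₁ hg₁ hg₁0 hu
    have hk : (h - c • f : H p) =ᵐ[weightMeasure p] alpha f₂ g₂ (alpha f₁ g₁ u) := by
      filter_upwards [hsub, hsmul, hfu, hhu,
        (weightMeasure_ac p).ae_le (ae_differentiableAt_of_mem_ACloc hu.2)] with x h1 h2 h3 h4 h5
      rw [h1, Pi.sub_apply, h2, Pi.smul_apply, h3, h4, hτ u x hu.1 h5, smul_eq_mul,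
        add_sub_cancel_right]
    have hgL : MemLp (alpha f₁ g₁ u) 2 (weightMeasure q) := by
      refine memLp_of_lagrange hq hm hm2 huAC hgAC ((memLp_congr_ae hfu).1 (Lp.memLp f))
        ((memLp_congr_ae hk).1 (Lp.memLp _)) ?_
      filter_upwards [ae_differentiableAt_of_mem_ACloc hgAC] with x hx
      exact hd u _ x (hu.1 x) hx
    exact ⟨hgL.toLp, ⟨u, huAC, hfu, hgL.coeFn_toLp⟩, _, hgAC, hgL.coeFn_toLp, hk⟩
  · rintro ⟨G, ⟨u, hu, hfu, hGu⟩, v, hv, hGv, hk⟩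
    obtain ⟨hu1, rfl⟩ := mem_AC1loc_of_alpha_ae_eq hf₁ hg₁ hf₁0 hg₁0 hu hv
      ((volume_ac_weightMeasure hq).ae_eq (hGu.symm.trans hGv))
    refine ⟨u, hu1, hfu, ?_⟩
    filter_upwards [hsub, hsmul, hfu, hk,
      (weightMeasure_ac p).ae_le (ae_differentiableAt_of_mem_ACloc hu1.2)] with x h1 h2 h3 h4 h5
    rw [hτ u x hu1.1 h5, ← h4, h1, Pi.sub_apply, h2, Pi.smul_apply, h3, smul_eq_mul,
      sub_add_cancel]

/-! ### Pointwise identities -/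

theorem hasDerivAt_polyFun (p : ℝ[X]) (x : ℝ) :
    HasDerivAt (polyFun p) (polyFun (derivative p) x) x :=
  (p.hasDerivAt x).ofReal_comp

theorem deriv_polyFun (p : ℝ[X]) : deriv (polyFun p) = polyFun (derivative p) :=
  funext fun x => (hasDerivAt_polyFun p x).deriv

theorem contDiff_polyFun (p : ℝ[X]) {n : WithTop ℕ∞} : ContDiff ℝ n (polyFun p) :=
  Complex.ofRealCLM.contDiff.comp (by simpa using p.contDiff_aeval (𝕜 := ℝ) n)

theorem polyFun_ne_zero {p : ℝ[X]} (hp : p ∈ NoRealZeros) (x : ℝ) : polyFun p x ≠ 0 :=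
  Complex.ofReal_ne_zero.2 (hp x)

theorem conj_polyFun (p : ℝ[X]) (x : ℝ) : starRingEnd ℂ (polyFun p x) = polyFun p x :=
  Complex.conj_ofReal _

theorem tilde_ne_zero {p : ℝ[X]} (hp : p ∈ NoRealZeros) (x : ℝ) : tilde (polyFun p) x ≠ 0 :=
  mul_ne_zero (polyFun_ne_zero hp x) (Complex.exp_ne_zero _)

theorem hasDerivAt_cexp_sq (x : ℝ) :
    HasDerivAt (fun x : ℝ => Complex.exp ((x : ℂ) ^ 2)) (2 * x * Complex.exp ((x : ℂ) ^ 2)) x := by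
  have h := ((Complex.ofRealCLM.hasDerivAt (x := x)).pow 2).cexp
  refine h.congr_deriv ?_
  simp
  ring

theorem hasDerivAt_cexp_neg_sq (x : ℝ) :
    HasDerivAt (fun x : ℝ => Complex.exp (-(x : ℂ) ^ 2))
      (-(2 * x) * Complex.exp (-(x : ℂ) ^ 2)) x := by
  have h := (((Complex.ofRealCLM.hasDerivAt (x := x)).pow 2).neg).cexp
  refine h.congr_deriv ?_
  simp
  ring

theorem contDiff_tilde (p : ℝ[X]) {n : WithTop ℕ∞} : ContDiff ℝ n (tilde (polyFun p)) :=
  (contDiff_polyFun p).mul ((Complex.ofRealCLM.contDiff.pow 2).cexp)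

/-- The Gaussian factors in `β` cancel, leaving rational coefficients. -/
theorem beta_apply (p q : ℝ[X]) (y : ℝ → ℂ) (x : ℝ) :
    beta (polyFun p) (polyFun q) y x = (polyFun q x)⁻¹ * (polyFun p x * deriv y x -
      (polyFun (derivative p) x + 2 * x * polyFun p x) * y x) := by
  have h : deriv (tilde (polyFun p)) x = _ :=
    ((hasDerivAt_polyFun p x).mul (hasDerivAt_cexp_sq x)).deriv
  have he := Complex.exp_ne_zero ((x : ℂ) ^ 2)
  simp only [beta, alpha, wr, h]
  simp only [tilde, mul_inv]
  field_simp

/-- The geometric mean of the weights `W_p` and `W_q`, up to sign. -/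
noncomputable def meanWeight (p q : ℝ[X]) : ℝ → ℂ := fun x =>
  (polyFun p x * polyFun q x)⁻¹ * Complex.exp (-(x : ℂ) ^ 2)

theorem contDiff_meanWeight {p q : ℝ[X]} (hp : p ∈ NoRealZeros) (hq : q ∈ NoRealZeros)
    {n : WithTop ℕ∞} : ContDiff ℝ n (meanWeight p q) :=
  (((contDiff_polyFun p).mul (contDiff_polyFun q)).inv
    fun x => mul_ne_zero (polyFun_ne_zero hp x) (polyFun_ne_zero hq x)).mul
    ((Complex.ofRealCLM.contDiff.pow 2).neg.cexp)

theorem norm_meanWeight_sq (p q : ℝ[X]) (x : ℝ) :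
    ‖meanWeight p q x‖ ^ 2 = weight p x * weight q x := by
  have h : meanWeight p q x =
      (((p.eval x * q.eval x)⁻¹ * Real.exp (-x ^ 2) : ℝ) : ℂ) := by
    simp [meanWeight, polyFun]
  rw [h, Complex.norm_real, Real.norm_eq_abs, sq_abs, weight, weight, mul_pow, inv_pow, mul_pow,
    mul_inv]
  ring

theorem conj_meanWeight (p q : ℝ[X]) (x : ℝ) :
    starRingEnd ℂ (meanWeight p q x) = meanWeight p q x := by
  simp only [meanWeight, map_mul, map_inv₀, conj_polyFun, ← Complex.exp_conj, map_neg, map_pow,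
    Complex.conj_ofReal]

theorem ofReal_weight (p : ℝ[X]) (x : ℝ) :
    (weight p x : ℂ) = (polyFun p x ^ 2)⁻¹ * Complex.exp (-(x : ℂ) ^ 2) := by
  simp [weight, polyFun]

theorem hasDerivAt_meanWeight {p q : ℝ[X]} (hp : p ∈ NoRealZeros) (hq : q ∈ NoRealZeros) (x : ℝ) :
    HasDerivAt (meanWeight p q)
      (-((polyFun (derivative p) x / polyFun p x + polyFun (derivative q) x / polyFun q x +
        2 * x) * meanWeight p q x)) x := by
  have h1 := polyFun_ne_zero hp x
  have h2 := polyFun_ne_zero hq x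
  have h := (((hasDerivAt_polyFun p x).mul (hasDerivAt_polyFun q x)).inv
    (mul_ne_zero h1 h2)).mul (hasDerivAt_cexp_neg_sq x)
  refine h.congr_deriv ?_
  simp only [meanWeight, Pi.mul_apply, Pi.inv_apply]
  field_simp
  ring

/-- The Lagrange identity: `α_{q,p}` and `-β_{p,q}` are formally adjoint. -/
theorem hasDerivAt_lagrange {p q : ℝ[X]} (hp : p ∈ NoRealZeros) (hq : q ∈ NoRealZeros)
    {y g : ℝ → ℂ} {x : ℝ} (hy : DifferentiableAt ℝ y x) (hg : DifferentiableAt ℝ g x) :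
    HasDerivAt (fun x => meanWeight p q x * (starRingEnd ℂ (y x) * g x))
      (weight q x * (starRingEnd ℂ (alpha (polyFun q) (polyFun p) y x) * g x) +
        weight p x * (starRingEnd ℂ (y x) * beta (polyFun p) (polyFun q) g x)) x := by
  have h1 := polyFun_ne_zero hp x
  have h2 := polyFun_ne_zero hq x
  have hyc : HasDerivAt (fun x => starRingEnd ℂ (y x)) (starRingEnd ℂ (deriv y x)) x :=
    hy.hasDerivAt.star
  refine ((hasDerivAt_meanWeight hp hq x).mul (hyc.mul hg.hasDerivAt)).congr_deriv ?_
  simp only [beta_apply, alpha, wr, deriv_polyFun, ofReal_weight, meanWeight, map_mul, map_sub,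
    map_inv₀, conj_polyFun, Pi.mul_apply]
  field_simp
  ring

section Factorization

variable {p q : ℝ[X]} {ε : ℂ}

theorem tau_eq_beta_alpha (hp : p ∈ NoRealZeros) (hq : q ∈ NoRealZeros)
    (hχ : ∀ x, chi (polyFun p) (polyFun q) x = ε * polyFun p x * polyFun q x)
    {y : ℝ → ℂ} {x : ℝ} (hy : Differentiable ℝ y) (hy' : DifferentiableAt ℝ (deriv y) x) :
    tau (polyFun p) y x =
      beta (polyFun p) (polyFun q) (alpha (polyFun q) (polyFun p) y) x + ε * y x := by
  have h1 := polyFun_ne_zero hp x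
  have h2 := polyFun_ne_zero hq x
  have hd : HasDerivAt (alpha (polyFun q) (polyFun p) y) _ x :=
    ((hasDerivAt_polyFun p x).inv h1).mul
      (((hasDerivAt_polyFun q x).mul hy'.hasDerivAt).sub
        (((deriv_polyFun q).symm ▸ hasDerivAt_polyFun (derivative q) x).mul (hy x).hasDerivAt))
  have hx := hχ x
  rw [beta_apply, hd.deriv]
  simp only [tau, chi, alpha, wr, deriv_polyFun, Pi.inv_apply] at hx ⊢
  field_simp
  linear_combination (y x) * hx

theorem tau_eq_alpha_beta (hp : p ∈ NoRealZeros) (hq : q ∈ NoRealZeros)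
    (hχ : ∀ x, chi (polyFun p) (polyFun q) x = ε * polyFun p x * polyFun q x)
    {y : ℝ → ℂ} {x : ℝ} (hy : Differentiable ℝ y) (hy' : DifferentiableAt ℝ (deriv y) x) :
    tau (polyFun q) y x =
      alpha (polyFun q) (polyFun p) (beta (polyFun p) (polyFun q) y) x + (ε + 2) * y x := by
  have h1 := polyFun_ne_zero hp x
  have h2 := polyFun_ne_zero hq x
  have hid : HasDerivAt (fun x : ℝ => 2 * (x : ℂ)) 2 x := by
    simpa using (Complex.ofRealCLM.hasDerivAt (x := x)).const_mul (2 : ℂ)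
  have hd : HasDerivAt (beta (polyFun p) (polyFun q) y) _ x :=
    (((hasDerivAt_polyFun q x).inv h2).mul
      (((hasDerivAt_polyFun p x).mul hy'.hasDerivAt).sub
        (((hasDerivAt_polyFun (derivative p) x).add
          (hid.mul (hasDerivAt_polyFun p x))).mul (hy x).hasDerivAt))).congr_of_eventuallyEq
      (Eventually.of_forall (beta_apply p q y))
  have hx := hχ x
  simp only [alpha, wr]
  rw [hd.deriv]
  simp only [tau, chi, beta_apply, deriv_polyFun, Pi.mul_apply, Pi.inv_apply, Pi.sub_apply,
    Pi.add_apply] at hx ⊢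
  field_simp
  linear_combination (y x) * hx

end Factorization

end XHermite

theorem mainTheorem7 (η ξ : ℝ[X]) (hη : η ∈ XHermite.NoRealZeros)
    (hξ : ξ ∈ XHermite.NoRealZeros) (ε₀ : ℝ)
    (hχ : ∀ x : ℝ, XHermite.chi (XHermite.polyFun η) (XHermite.polyFun ξ) x =
      (ε₀ : ℂ) * XHermite.polyFun η x * XHermite.polyFun ξ x) :
    XHermite.T η =
        XHermite.addScalar (XHermite.natComp (XHermite.B η ξ) (XHermite.A ξ η)) (ε₀ : ℂ) ∧
      XHermite.T ξ =
        XHermite.addScalar (XHermite.natComp (XHermite.A ξ η) (XHermite.B η ξ))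
          ((ε₀ : ℂ) + 2) := by
  open XHermite in
  refine ⟨maximalOp_tau_eq_of_factorization hη hξ (m := meanWeight η ξ) _ (contDiff_polyFun ξ)
    (contDiff_polyFun η) (polyFun_ne_zero hξ) (polyFun_ne_zero hη) (contDiff_meanWeight hη hξ)
    (norm_meanWeight_sq η ξ) (fun y x hy hy' => tau_eq_beta_alpha hη hξ hχ hy hy')
    (fun y g x hy hg => hasDerivAt_lagrange hη hξ hy hg),
    maximalOp_tau_eq_of_factorization hξ hη (m := meanWeight η ξ) _ (contDiff_tilde η)
    (contDiff_tilde ξ) (tilde_ne_zero hη) (tilde_ne_zero hξ) (contDiff_meanWeight hη hξ)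
    (fun x => (norm_meanWeight_sq η ξ x).trans (mul_comm _ _))
    (fun y x hy hy' => tau_eq_alpha_beta hη hξ hχ hy hy') (fun y g x hy hg => ?_)⟩
  -- the Lagrange identity with the roles of `y` and `g` exchanged, conjugated
  have h := (hasDerivAt_lagrange hη hξ hg hy).star
  refine (h.congr_deriv ?_).congr_of_eventuallyEq (Eventually.of_forall fun t => ?_)
  · simp only [← starRingEnd_apply, map_add, map_mul, Complex.conj_ofReal, Complex.conj_conj, beta]
    ring
  · simp only [← starRingEnd_apply, map_mul, conj_meanWeight, Complex.conj_conj]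
    ring
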